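/- Let $K$ be a field, let $\Lambda$ and $\Gamma$ be finite-dimensional $K$-algebras, let $M$ be a finitely generated left $\Lambda$-module and $N$ a finitely generated left $\Gamma$-module. Regard $M\otimes_K N$ as a left $\Lambda\otimes_K\Gamma$-module via $(a\otimes b)(m\otimes n)=am\otimes bn$. For a finitely generated left module $X$ over a finite-dimensional $K$-algebra, with minimal projective resolution $\cdots\to P_1\to P_0\to X\to 0$, the complexity of $X$ is $$\operatorname{cx}(X)=\inf\{\,b\in\mathbb{N}_0 \mid \text{there is } c>0 \text{ such that } \dim_K P_n\le c\,n^{b-1}\text{ for all } n\ge 1\,\},$$ with $\operatorname{cx}(X)=\infty$ if there is no such $b$. Then $$\operatorname{cx}(M\otimes_K N)\le \operatorname{cx}(M)+\operatorname{cx}(N),$$ and, if $M\ne 0$ and $N\ne 0$, also $$\max\{\operatorname{cx}(M),\operatorname{cx}(N)\}\le \operatorname{cx}(M\otimes_K N).$$ -/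

import Mathlib

open scoped TensorProduct

universe u v w

/-- A submodule `S` of `P` is superfluous (small) if `T + S = P` forces `T = P`. -/
def IsSuperfluous {R : Type v} [Ring R] {P : Type w} [AddCommGroup P] [Module R P]
    (S : Submodule R P) : Prop :=
  ∀ T : Submodule R P, T ⊔ S = ⊤ → T = ⊤

/-- A minimal projective resolution `⋯ → P 1 → P 0 → M → 0` of a module `M` over a `K`-algebra `Λ`,
with finitely generated terms: an exact sequence in which every `P n` is projective and each of the
surjections `P 0 → M` and `P (n + 1) → im (d n)` is a projective cover, that is, has superfluous
kernel. The `K`-structure on `P n` is the one induced by its `Λ`-structure. Finitely generated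
`Λ`-modules have isomorphic copies in the universe of `Λ`, so the terms are taken there. -/
structure MinimalProjectiveResolution (K : Type u) [Field K] (Λ : Type v) [Ring Λ] [Algebra K Λ]
    (M : Type w) [AddCommGroup M] [Module Λ M] where
  P : ℕ → Type v
  [addCommGroup : ∀ n, AddCommGroup (P n)]
  [moduleBase : ∀ n, Module K (P n)]
  [module : ∀ n, Module Λ (P n)]
  [isScalarTower : ∀ n, IsScalarTower K Λ (P n)]
  finite : ∀ n, Module.Finite Λ (P n)
  projective : ∀ n, Module.Projective Λ (P n)
  aug : P 0 →ₗ[Λ] M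
  d : ∀ n, P (n + 1) →ₗ[Λ] P n
  surjective : Function.Surjective aug
  exact_zero : Function.Exact (d 0) aug
  exact_succ : ∀ n, Function.Exact (d (n + 1)) (d n)
  minimal_zero : IsSuperfluous (LinearMap.ker aug)
  minimal_succ : ∀ n, IsSuperfluous (LinearMap.ker (d n))

attribute [instance] MinimalProjectiveResolution.addCommGroup
  MinimalProjectiveResolution.moduleBase MinimalProjectiveResolution.module
  MinimalProjectiveResolution.isScalarTower

/-- The complexity of `M`: the infimum of the natural numbers `b` for which there is `c > 0` with
`dim_K (P n) ≤ c * n ^ (b - 1)` for all `n ≥ 1`, where `P` is a minimal projective resolution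
of `M`. It is `⊤` if there is no such `b`. The exponent is an integer (it is `-1` for `b = 0`). -/
noncomputable def complexity (K : Type u) [Field K] (Λ : Type v) [Ring Λ] [Algebra K Λ]
    (M : Type w) [AddCommGroup M] [Module Λ M] : ℕ∞ :=
  sInf ((fun b : ℕ => (b : ℕ∞)) '' {b : ℕ | ∃ F : MinimalProjectiveResolution K Λ M,
    ∃ c : ℝ, 0 < c ∧ ∀ n : ℕ, 1 ≤ n →
      (Module.finrank K (F.P n) : ℝ) ≤ c * (n : ℝ) ^ ((b : ℤ) - 1)})

/-- The `Λ ⊗[K] Γ`-module structure on `M ⊗[K] N` given by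
`(a ⊗ b) • (m ⊗ n) = (a • m) ⊗ (b • n)`. -/
@[reducible]
noncomputable def tensorModule (K Λ Γ M N : Type*) [Field K]
    [Ring Λ] [Algebra K Λ] [Ring Γ] [Algebra K Γ]
    [AddCommGroup M] [Module K M] [Module Λ M] [IsScalarTower K Λ M]
    [AddCommGroup N] [Module K N] [Module Γ N] [IsScalarTower K Γ N] :
    Module (Λ ⊗[K] Γ) (M ⊗[K] N) :=
  Module.compHom (M ⊗[K] N)
    ((Module.endTensorEndAlgHom (R := K) (S := K) (A := K) (M := M) (N := N)).comp
      (Algebra.TensorProduct.map (Algebra.lsmul K K M) (Algebra.lsmul K K N))).toRingHom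

theorem tensorModule_tmul_smul_tmul (K Λ Γ M N : Type*) [Field K]
    [Ring Λ] [Algebra K Λ] [Ring Γ] [Algebra K Γ]
    [AddCommGroup M] [Module K M] [Module Λ M] [IsScalarTower K Λ M]
    [AddCommGroup N] [Module K N] [Module Γ N] [IsScalarTower K Γ N]
    (a : Λ) (b : Γ) (m : M) (n : N) :
    letI := tensorModule K Λ Γ M N
    (a ⊗ₜ[K] b) • (m ⊗ₜ[K] n) = (a • m) ⊗ₜ[K] (b • n) := rfl

-- The minimal resolution is termwise no larger than any other projective resolution, so both bounds
-- reduce to producing projective resolutions whose terms are small enough.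
--
-- Upper bound: tensoring minimal resolutions `F` of `M` and `G` of `N` should give a resolution of
-- `M ⊗ N` whose `n`-th term has dimension `∑ dim F_i * dim G_j` over `i + j = n`. No total complex
-- is formed. Only the dimension of the `n`-th term matters, and `HasSyzygyBound` records just that.
-- It is propagated by induction along `0 → M ⊗ ΩN → M ⊗ G_0 → M ⊗ N → 0`, using the horseshoe lemma
-- (`HasSyzygyBound.horseshoe`, `HasSyzygyBound.cone`). The convolution of sequences of rates `a`
-- and `b` has rate `a + b` (`HasGrowthRate.convolution`).
--
-- Lower bound: `Λ ⊗ Γ` is projective over `Λ`, so a `Λ ⊗ Γ`-resolution of `M ⊗ N` is also a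
-- projective resolution over `Λ`. Over `Λ`, a nonzero `N` makes `M` a direct summand of `M ⊗ N`.
-- The comparison `MinimalProjectiveResolution.finrank_le` is therefore proved for retracts. It also
-- replaces uniqueness of minimal resolutions, which is never needed.

universe x y

/-! ### Syzygy bounds and comparison with minimal resolutions -/

section General

variable (K : Type u) [Field K] (A : Type v) [Ring A] [Algebra K A]

/-- `X` has a partial projective resolution of length `n`, with terms of finite dimension over `K`,
whose last term has dimension at most `d`. -/
def HasSyzygyBound : ℕ → ∀ (X : Type w) [AddCommGroup X] [Module A X], ℕ → Prop
  | 0, X, _, _, d => ∃ (P : Type w) (_ : AddCommGroup P) (_ : Module K P) (_ : Module A P)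
      (_ : IsScalarTower K A P) (p : P →ₗ[A] X), Module.Finite K P ∧ Module.Projective A P ∧
      Function.Surjective p ∧ Module.finrank K P ≤ d
  | n + 1, X, _, _, d => ∃ (P : Type w) (_ : AddCommGroup P) (_ : Module K P) (_ : Module A P)
      (_ : IsScalarTower K A P) (p : P →ₗ[A] X), Module.Finite K P ∧ Module.Projective A P ∧
      Function.Surjective p ∧ HasSyzygyBound n (LinearMap.ker p) d

variable {K A}

theorem Function.Exact.coprod_surjective {X : Type*} {Y : Type*} {Z : Type*} {P : Type*} {Q : Type*}
    [AddCommGroup X] [Module A X] [AddCommGroup Y] [Module A Y] [AddCommGroup Z] [Module A Z]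
    [AddCommGroup P] [Module A P] [AddCommGroup Q] [Module A Q] {i : X →ₗ[A] Y} {p : Y →ₗ[A] Z}
    (hip : Function.Exact i p) {f : P →ₗ[A] X} {g : Q →ₗ[A] Z} {t : Q →ₗ[A] Y}
    (hf : Function.Surjective f) (hg : Function.Surjective g) (ht : p ∘ₗ t = g) :
    Function.Surjective ((i ∘ₗ f).coprod t) := by
  intro y
  obtain ⟨q, hq⟩ := hg (p y)
  obtain ⟨x, hx⟩ := (hip (y - t q)).1 (by
    rw [map_sub, ← hq, ← ht]; simp)
  obtain ⟨r, rfl⟩ := hf x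
  exact ⟨(r, q), by simp [hx]⟩

namespace HasSyzygyBound

theorem congr {n d : ℕ} {X Y : Type w} [AddCommGroup X] [Module A X] [AddCommGroup Y] [Module A Y]
    (e : X ≃ₗ[A] Y) (h : HasSyzygyBound K A n X d) : HasSyzygyBound K A n Y d := by
  cases n with
  | zero =>
    obtain ⟨P, _, _, _, _, p, h1, h2, h3, h4⟩ := h
    exact ⟨P, _, _, _, ‹_›, e.toLinearMap ∘ₗ p, h1, h2, e.surjective.comp h3, h4⟩
  | succ n =>
    obtain ⟨P, _, _, _, _, p, h1, h2, h3, h4⟩ := h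
    refine ⟨P, _, _, _, ‹_›, e.toLinearMap ∘ₗ p, h1, h2, e.surjective.comp h3, ?_⟩
    rw [LinearEquiv.ker_comp]
    exact h4

theorem ker_of_exact {n d : ℕ} {L X : Type w} {P : Type x} [AddCommGroup L] [Module A L]
    [AddCommGroup P] [Module A P] [AddCommGroup X] [Module A X] {i : L →ₗ[A] X} {p : X →ₗ[A] P}
    (hi : Function.Injective i) (hip : Function.Exact i p) (h : HasSyzygyBound K A n L d) :
    HasSyzygyBound K A n (LinearMap.ker p) d :=
  h.congr ((LinearEquiv.ofInjective i hi).trans (LinearEquiv.ofEq _ _ hip.linearMap_ker_eq.symm))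

/-- The cover of `Z` lifts to `Y`, so the sum of the two covers maps onto `Y`. The kernels again
form a short exact sequence, to which induction applies. -/
theorem horseshoe {n a c : ℕ} {X Y Z : Type w} [AddCommGroup X] [Module A X] [AddCommGroup Y]
    [Module A Y] [AddCommGroup Z] [Module A Z] {i : X →ₗ[A] Y} {p : Y →ₗ[A] Z}
    (hi : Function.Injective i) (hip : Function.Exact i p) (hp : Function.Surjective p)
    (hX : HasSyzygyBound K A n X a) (hZ : HasSyzygyBound K A n Z c) :
    HasSyzygyBound K A n Y (a + c) := by
  induction n generalizing X Y Z with
  | zero =>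
    obtain ⟨P, _, _, _, _, f, h1, h2, h3, h4⟩ := hX
    obtain ⟨Q, _, _, _, _, g, k1, k2, k3, k4⟩ := hZ
    obtain ⟨t, ht⟩ := Module.projective_lifting_property p g hp
    refine ⟨P × Q, _, inferInstance, inferInstance, inferInstance, (i ∘ₗ f).coprod t,
      inferInstance, inferInstance, hip.coprod_surjective h3 k3 ht, ?_⟩
    rw [Module.finrank_prod]
    omega
  | succ n ih =>
    obtain ⟨P, _, _, _, _, f, h1, h2, h3, h4⟩ := hX
    obtain ⟨Q, _, _, _, _, g, k1, k2, k3, k4⟩ := hZ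
    obtain ⟨t, ht⟩ := Module.projective_lifting_property p g hp
    refine ⟨P × Q, _, inferInstance, inferInstance, inferInstance, (i ∘ₗ f).coprod t,
      inferInstance, inferInstance, hip.coprod_surjective h3 k3 ht, ?_⟩
    have pt : ∀ y, p (t y) = g y := fun y => LinearMap.congr_fun ht y
    have pi : ∀ y, p (i y) = 0 := hip.apply_apply_eq_zero
    let j : LinearMap.ker f →ₗ[A] LinearMap.ker ((i ∘ₗ f).coprod t) :=
      (LinearMap.inl A P Q ∘ₗ (LinearMap.ker f).subtype).codRestrict _ (by
        rintro ⟨z, hz⟩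
        simp only [LinearMap.mem_ker] at hz ⊢
        simp [hz])
    let q : LinearMap.ker ((i ∘ₗ f).coprod t) →ₗ[A] LinearMap.ker g :=
      (LinearMap.snd A P Q ∘ₗ (LinearMap.ker _).subtype).codRestrict _ (by
        rintro ⟨⟨r, s⟩, hz⟩
        have := congrArg p (LinearMap.mem_ker.1 hz)
        simpa [pt, pi] using this)
    refine ih (i := j) (p := q) ?_ ?_ ?_ h4 k4
    · intro r s hrs
      have := congrArg (fun z => z.1.1) hrs
      exact Subtype.ext this
    · rintro ⟨⟨r, s⟩, hz⟩
      constructor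
      · intro h
        have hs : s = 0 := congrArg Subtype.val h
        subst hs
        have : f r = 0 := hi (by simpa using hz)
        exact ⟨⟨r, this⟩, rfl⟩
      · rintro ⟨r', h⟩
        have : s = 0 := (congrArg (fun z => z.1.2) h).symm
        exact Subtype.ext this
    · rintro ⟨s, hs⟩
      -- For `s` in `ker g`, the lift `t s` lies in the image of `i ∘ f`; subtracting a preimage
      -- moves `(0, s)` into the kernel.
      obtain ⟨x, hx⟩ := (hip (t s)).1 (by rw [pt]; exact hs)
      obtain ⟨r, rfl⟩ := h3 x
      exact ⟨⟨(-r, s), by simp [hx]⟩, rfl⟩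

/-- The cover `P → Y` also covers `Z`, and the kernel of `P → Z` is an extension of `ker p` by the
syzygy of `Y`. This accounts for the degree shift on `ker p`, as in a mapping cone. -/
theorem cone {n a b : ℕ} {Y Z : Type w} [AddCommGroup Y]
    [Module A Y] [AddCommGroup Z] [Module A Z] {p : Y →ₗ[A] Z} (hp : Function.Surjective p)
    (hY : HasSyzygyBound K A (n + 1) Y b) (hX : HasSyzygyBound K A n (LinearMap.ker p) a) :
    HasSyzygyBound K A (n + 1) Z (b + a) := by
  obtain ⟨P, _, _, _, _, f, h1, h2, h3, h4⟩ := hY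
  refine ⟨P, _, _, _, ‹_›, p ∘ₗ f, h1, h2, hp.comp h3, ?_⟩
  let j : LinearMap.ker f →ₗ[A] LinearMap.ker (p ∘ₗ f) :=
    Submodule.inclusion (LinearMap.ker_le_ker_comp f p)
  let q : LinearMap.ker (p ∘ₗ f) →ₗ[A] LinearMap.ker p :=
    (f ∘ₗ (LinearMap.ker (p ∘ₗ f)).subtype).codRestrict _ (fun z => z.2)
  refine horseshoe (i := j) (p := q) (Submodule.inclusion_injective _) ?_ ?_ h4 hX
  · rintro ⟨z, hz⟩
    constructor
    · intro h
      exact ⟨⟨z, congrArg Subtype.val h⟩, rfl⟩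
    · rintro ⟨⟨r, hr⟩, h⟩
      have : r = z := congrArg Subtype.val h
      subst this
      exact Subtype.ext hr
  · rintro ⟨y, hy⟩
    obtain ⟨z, rfl⟩ := h3 y
    exact ⟨⟨z, hy⟩, rfl⟩

end HasSyzygyBound

theorem IsSuperfluous.surjective_of_comp {P : Type w} {X : Type x} {Q : Type y} [AddCommGroup P]
    [Module A P] [AddCommGroup X] [Module A X] [AddCommGroup Q] [Module A Q] {p : P →ₗ[A] X}
    (hp : IsSuperfluous (LinearMap.ker p)) {f : Q →ₗ[A] P}
    (hf : Function.Surjective (p ∘ₗ f)) : Function.Surjective f := by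
  rw [← LinearMap.range_eq_top]
  refine hp _ (eq_top_iff.2 fun z _ => ?_)
  obtain ⟨q, hq⟩ := hf (p z)
  rw [← add_sub_cancel (f q) z]
  refine Submodule.add_mem_sup ⟨q, rfl⟩ ?_
  rw [LinearMap.mem_ker, map_sub, sub_eq_zero]
  exact hq.symm

namespace MinimalProjectiveResolution

/-- A minimal projective resolution of `M` is one of any module isomorphic to `M`. -/
def congr {M : Type w} [AddCommGroup M] [Module A M] {M' : Type x} [AddCommGroup M'] [Module A M']
    (F : MinimalProjectiveResolution K A M) (e : M ≃ₗ[A] M') :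
    MinimalProjectiveResolution K A M' where
  P := F.P
  finite := F.finite
  projective := F.projective
  aug := e.toLinearMap ∘ₗ F.aug
  d := F.d
  surjective := e.surjective.comp F.surjective
  exact_zero := by
    rw [LinearMap.exact_iff, LinearEquiv.ker_comp]
    exact F.exact_zero.linearMap_ker_eq
  exact_succ := F.exact_succ
  minimal_zero := by
    rw [LinearEquiv.ker_comp]
    exact F.minimal_zero
  minimal_succ := F.minimal_succ

/-- The minimal projective resolution of the first syzygy. -/
def shift {M : Type w} [AddCommGroup M] [Module A M] (F : MinimalProjectiveResolution K A M) :
    MinimalProjectiveResolution K A (LinearMap.ker F.aug) where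
  P n := F.P (n + 1)
  finite n := F.finite (n + 1)
  projective n := F.projective (n + 1)
  aug := (F.d 0).codRestrict _ fun z => LinearMap.mem_ker.2 (F.exact_zero.apply_apply_eq_zero z)
  d n := F.d (n + 1)
  surjective := by
    rintro ⟨z, hz⟩
    obtain ⟨t, rfl⟩ := (F.exact_zero z).1 hz
    exact ⟨t, rfl⟩
  exact_zero := by
    rw [LinearMap.exact_iff, LinearMap.ker_codRestrict]
    exact (F.exact_succ 0).linearMap_ker_eq
  exact_succ n := F.exact_succ (n + 1)
  minimal_zero := by
    rw [LinearMap.ker_codRestrict]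
    exact F.minimal_succ 0
  minimal_succ n := F.minimal_succ (n + 1)

theorem finite_base [FiniteDimensional K A] {M : Type w} [AddCommGroup M] [Module A M]
    (F : MinimalProjectiveResolution K A M) (n : ℕ) : Module.Finite K (F.P n) :=
  have := F.finite n
  Module.Finite.trans A (F.P n)

/-- If `M` is a retract of `X`, then the terms of a minimal projective resolution of `M` are at most
as large as those of any projective resolution of `X`. -/
theorem finrank_le [FiniteDimensional K A] {n d : ℕ} {M : Type v} [AddCommGroup M] [Module A M]
    (F : MinimalProjectiveResolution K A M) {X : Type x} [AddCommGroup X] [Module A X]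
    (ι : M →ₗ[A] X) (π : X →ₗ[A] M) (hπ : Function.Bijective (π ∘ₗ ι))
    (h : HasSyzygyBound K A n X d) : Module.finrank K (F.P n) ≤ d := by
  have hπs : Function.Surjective π := by
    have := hπ.2
    rw [LinearMap.coe_comp] at this
    exact this.of_comp
  induction n generalizing M X with
  | zero =>
    obtain ⟨P, _, _, _, _, p, h1, h2, h3, h4⟩ := h
    obtain ⟨f, hf⟩ := Module.projective_lifting_property F.aug (π ∘ₗ p) F.surjective
    have hs : Function.Surjective f := F.minimal_zero.surjective_of_comp (by
      rw [hf]; exact hπs.comp h3)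
    exact (LinearMap.finrank_le_finrank_of_surjective (f := f.restrictScalars K) hs).trans h4
  | succ n ih =>
    obtain ⟨P, _, _, _, _, p, h1, h2, h3, h4⟩ := h
    have := F.projective 0
    have := F.finite_base 0
    obtain ⟨f, hf⟩ := Module.projective_lifting_property F.aug (π ∘ₗ p) F.surjective
    obtain ⟨s, hs⟩ := Module.projective_lifting_property p (ι ∘ₗ F.aug) h3
    have hf' : ∀ z, F.aug (f z) = π (p z) := LinearMap.congr_fun hf
    have hs' : ∀ z, p (s z) = ι (F.aug z) := LinearMap.congr_fun hs
    -- The composite `F.P 0 → P → F.P 0` lifts the automorphism `π ∘ ι`, so minimality makes it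
    -- onto, and finite dimension makes it bijective.
    have hg : Function.Surjective (f ∘ₗ s) := F.minimal_zero.surjective_of_comp (by
      have : F.aug ∘ₗ (f ∘ₗ s) = (π ∘ₗ ι) ∘ₗ F.aug := by
        ext z; simp [hf', hs']
      rw [this]
      exact hπ.2.comp F.surjective)
    have hgi : Function.Injective (f ∘ₗ s) :=
      (LinearMap.injective_iff_surjective (f := (f ∘ₗ s).restrictScalars K)).2 hg
    -- The syzygy of `M` is thus a retract of `ker p`, but only up to an automorphism. Hence the
    -- induction carries bijectivity of `π ∘ ι` rather than `π ∘ ι = id`.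
    have hb : Function.Bijective
        ((f.restrict (p := LinearMap.ker p) (q := LinearMap.ker F.aug)
          (fun z hz => by simp_all)) ∘ₗ
        (s.restrict (p := LinearMap.ker F.aug) (q := LinearMap.ker p)
          (fun z hz => by simp_all))) := by
      constructor
      · intro a b hab
        exact Subtype.ext (hgi (congrArg Subtype.val hab))
      · rintro ⟨z, hz⟩
        obtain ⟨t, rfl⟩ := hg z
        refine ⟨⟨t, ?_⟩, rfl⟩
        refine hπ.1 ?_
        simpa [hf', hs'] using hz
    refine ih F.shift _ _ hb h4 ?_
    have := hb.2
    rw [LinearMap.coe_comp] at this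
    exact this.of_comp

end MinimalProjectiveResolution

theorem complexity_congr {M : Type w} [AddCommGroup M] [Module A M] {M' : Type x}
    [AddCommGroup M'] [Module A M'] (e : M ≃ₗ[A] M') :
    complexity K A M = complexity K A M' := by
  unfold complexity
  congr 2
  ext b
  exact ⟨fun ⟨F, h⟩ => ⟨F.congr e, h⟩, fun ⟨F, h⟩ => ⟨F.congr e.symm, h⟩⟩

end General

/-! ### Existence of minimal projective resolutions -/

section Existence

variable (K : Type u) [Field K] {A : Type v} [Ring A] [Algebra K A]

/-- A projective module of least `K`-dimension mapping onto `M` is a projective cover: a proper `T`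
with `T + ker p = P` would yield, by Fitting's lemma, a smaller direct summand still mapping onto
`M`. -/
theorem exists_projective_cover [FiniteDimensional K A] (M : Type w) [AddCommGroup M] [Module A M]
    [Module.Finite A M] :
    ∃ (P : Type v) (_ : AddCommGroup P) (_ : Module K P) (_ : Module A P)
      (_ : IsScalarTower K A P) (p : P →ₗ[A] M), Module.Finite A P ∧ Module.Projective A P ∧
      Function.Surjective p ∧ IsSuperfluous (LinearMap.ker p) := by
  let S : Set ℕ := {m | ∃ (P : Type v) (_ : AddCommGroup P) (_ : Module K P) (_ : Module A P)
    (_ : IsScalarTower K A P) (p : P →ₗ[A] M), Module.Finite A P ∧ Module.Projective A P ∧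
      Function.Surjective p ∧ Module.finrank K P = m}
  have hS : S.Nonempty := by
    obtain ⟨n, f, hf⟩ := Module.Finite.exists_fin' A M
    exact ⟨_, Fin n → A, inferInstance, inferInstance, inferInstance, inferInstance, f,
      inferInstance, inferInstance, hf, rfl⟩
  obtain ⟨P, _, _, _, _, p, h1, h2, h3, h4⟩ := Nat.sInf_mem hS
  refine ⟨P, _, _, _, ‹_›, p, h1, h2, h3, fun T hT => ?_⟩
  have : Module.Finite K P := Module.Finite.trans A P
  have : IsArtinian A P := isArtinian_of_tower K inferInstance
  have : IsNoetherian A P := isNoetherian_of_tower K inferInstance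
  have hTs : Function.Surjective (p ∘ₗ T.subtype) := by
    intro m
    obtain ⟨z, rfl⟩ := h3 m
    obtain ⟨t, ht, k, hk, rfl⟩ := Submodule.mem_sup.1 (hT ▸ Submodule.mem_top : z ∈ T ⊔ _)
    exact ⟨⟨t, ht⟩, by simp [LinearMap.mem_ker.1 hk]⟩
  obtain ⟨f, hf⟩ := Module.projective_lifting_property _ p hTs
  let g : P →ₗ[A] P := T.subtype ∘ₗ f
  have hg : ∀ z, p (g z) = p z := LinearMap.congr_fun hf
  obtain ⟨n, hn⟩ := (g.eventually_isCompl_ker_pow_range_pow).exists_forall_of_atTop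
  -- The exponent is positive, so the range of the power lies in the range of `g`, hence in `T`.
  have hc := hn (n + 1) (by omega)
  have hpow : ∀ (k : ℕ) z, p ((g ^ k) z) = p z := by
    intro k
    induction k with
    | zero => simp
    | succ k ih => intro z; rw [pow_succ, Module.End.mul_apply, ih, hg]
  let R := LinearMap.range (g ^ (n + 1))
  have hR : Module.Projective A R :=
    Module.Projective.of_split R.subtype (Submodule.projectionOnto _ _ hc.symm) (by
      ext z; simp)
  have hle : Module.finrank K P ≤ Module.finrank K R := by
    rw [h4]
    refine Nat.sInf_le ⟨R, inferInstance, inferInstance, inferInstance, inferInstance,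
      p ∘ₗ R.subtype, inferInstance, hR, fun m => ?_, rfl⟩
    obtain ⟨z, rfl⟩ := h3 m
    exact ⟨⟨_, ⟨z, rfl⟩⟩, hpow (n + 1) z⟩
  have htop : R.restrictScalars K = ⊤ :=
    Submodule.eq_top_of_finrank_eq (le_antisymm (Submodule.finrank_le _) hle)
  refine eq_top_iff.2 fun z _ => ?_
  have hz : z ∈ R.restrictScalars K := htop ▸ Submodule.mem_top
  obtain ⟨t, rfl⟩ := hz
  rw [pow_succ', Module.End.mul_apply]
  exact (f _).2

variable (A) in
/-- A finitely generated module in the universe of the ring. -/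
structure FGModule where
  carrier : Type v
  [addCommGroup : AddCommGroup carrier]
  [module : Module A carrier]
  [finite : Module.Finite A carrier]

attribute [instance] FGModule.addCommGroup FGModule.module FGModule.finite

variable (A) in
/-- A projective cover of a module `Z`, with a finitely generated kernel. -/
structure ProjectiveCover (Z : Type v) [AddCommGroup Z] [Module A Z] where
  P : Type v
  [addCommGroup : AddCommGroup P]
  [moduleBase : Module K P]
  [module : Module A P]
  [isScalarTower : IsScalarTower K A P]
  [finite : Module.Finite A P]
  projective : Module.Projective A P
  p : P →ₗ[A] Z
  surjective : Function.Surjective p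
  minimal : IsSuperfluous (LinearMap.ker p)
  finite_ker : Module.Finite A (LinearMap.ker p)

attribute [instance] ProjectiveCover.addCommGroup ProjectiveCover.moduleBase
  ProjectiveCover.module ProjectiveCover.isScalarTower ProjectiveCover.finite
  ProjectiveCover.finite_ker

variable [FiniteDimensional K A]

theorem nonempty_projectiveCover (Z : Type v) [AddCommGroup Z] [Module A Z] [Module.Finite A Z] :
    Nonempty (ProjectiveCover K A Z) := by
  obtain ⟨P, _, _, _, _, p, h1, h2, h3, h4⟩ := exists_projective_cover K (A := A) Z
  have : Module.Finite K P := Module.Finite.trans A P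
  have : IsNoetherian A P := isNoetherian_of_tower K inferInstance
  exact ⟨{ P := P, projective := h2, p := p, surjective := h3, minimal := h4,
           finite_ker := inferInstance }⟩

/-- A choice of projective cover of a finitely generated module. -/
noncomputable def FGModule.cover (Z : FGModule A) : ProjectiveCover K A Z.carrier :=
  (nonempty_projectiveCover K Z.carrier).some

/-- The iterated syzygies of a finitely generated module. -/
noncomputable def FGModule.syzygy (Z : FGModule A) : ℕ → FGModule A
  | 0 => Z
  | n + 1 => { carrier := LinearMap.ker ((FGModule.syzygy Z n).cover K).p }

/-- Projective covers of the iterated syzygies are spliced together. -/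
theorem MinimalProjectiveResolution.nonempty (M : Type v) [AddCommGroup M] [Module A M]
    [Module.Finite A M] : Nonempty (MinimalProjectiveResolution K A M) := by
  let Z : ℕ → FGModule A := FGModule.syzygy K (@FGModule.mk A _ M _ _ _)
  let C : ∀ n, ProjectiveCover K A (Z n).carrier := fun n => (Z n).cover K
  let d : ∀ n, (C (n + 1)).P →ₗ[A] (C n).P := fun n =>
    (LinearMap.ker (C n).p).subtype ∘ₗ (C (n + 1)).p
  have hker : ∀ n, LinearMap.ker (d n) = LinearMap.ker (C (n + 1)).p := fun n =>
    LinearMap.ker_comp_of_ker_eq_bot _ (Submodule.ker_subtype _)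
  have hrange : ∀ n, LinearMap.range (d n) = LinearMap.ker (C n).p := fun n =>
    (LinearMap.range_comp_of_range_eq_top _
      (LinearMap.range_eq_top.2 (C (n + 1)).surjective)).trans (Submodule.range_subtype _)
  have hexact : Function.Exact (d 0) (C 0).p := LinearMap.exact_iff.2 (hrange 0).symm
  exact ⟨{
    P := fun n => (C n).P
    finite := fun n => inferInstance
    projective := fun n => (C n).projective
    aug := (C 0).p
    d := d
    surjective := (C 0).surjective
    exact_zero := hexact
    exact_succ := fun n => LinearMap.exact_iff.2 ((hker n).trans (hrange (n + 1)).symm)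
    minimal_zero := (C 0).minimal
    minimal_succ := fun n => by rw [hker]; exact (C (n + 1)).minimal }⟩

end Existence

/-! ### Restriction of scalars along an algebra map -/

section RestrictScalars

variable {K : Type u} [Field K] {A : Type v} [Ring A] [Algebra K A] {B : Type w} [Ring B]
  [Algebra K B] (φ : A →ₐ[K] B)

/-- A linear map, as a linear map between the modules obtained by restriction along `φ`. -/
@[reducible]
def LinearMap.compHom {X : Type x} [AddCommGroup X] [Module B X] {Y : Type y} [AddCommGroup Y]
    [Module B Y] (f : X →ₗ[B] Y) :
    letI := Module.compHom X φ.toRingHom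
    letI := Module.compHom Y φ.toRingHom
    X →ₗ[A] Y :=
  letI := Module.compHom X φ.toRingHom
  letI := Module.compHom Y φ.toRingHom
  { toFun := f
    map_add' := f.map_add
    map_smul' := fun a z => f.map_smul (φ a) z }

/-- `P` is a direct summand of a free `B`-module, which over `A` is a direct sum of copies of the
projective module `B`. -/
theorem Module.Projective.compHom
    (hB : letI := Module.compHom B φ.toRingHom; Module.Projective A B)
    (P : Type x) [AddCommGroup P] [Module B P] [hP : Module.Projective B P] :
    letI := Module.compHom P φ.toRingHom
    Module.Projective A P := by
  let := Module.compHom B φ.toRingHom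
  let := Module.compHom P φ.toRingHom
  obtain ⟨s, hs⟩ := hP.out
  have : Module.Projective A B := hB
  classical
  have : Module.Projective A (P →₀ B) := .of_equiv (finsuppLequivDFinsupp A).symm
  let i : P →ₗ[A] (P →₀ B) :=
    { toFun := s
      map_add' := s.map_add
      map_smul' := fun a z => (s.map_smul (φ a) z).trans (by ext t; rfl) }
  let p : (P →₀ B) →ₗ[A] P :=
    { toFun := Finsupp.linearCombination B id
      map_add' := map_add _
      map_smul' := fun a z => by
        have : a • z = φ a • z := by ext t; rfl
        rw [this]
        exact map_smul (Finsupp.linearCombination B id) (φ a) z }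
  exact Module.Projective.of_split i p (LinearMap.ext hs)

/-- A projective resolution over `B` is one over `A` if `B` is projective over `A`. -/
theorem MinimalProjectiveResolution.hasSyzygyBound_compHom [FiniteDimensional K B]
    (hB : letI := Module.compHom B φ.toRingHom; Module.Projective A B) (n : ℕ) {X : Type w}
    [AddCommGroup X] [Module B X] (R : MinimalProjectiveResolution K B X) :
    letI := Module.compHom X φ.toRingHom
    HasSyzygyBound K A n X (Module.finrank K (R.P n)) := by
  have tower : ∀ (P : Type w) [AddCommGroup P] [Module K P] [Module B P] [IsScalarTower K B P],
      letI := Module.compHom P φ.toRingHom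
      IsScalarTower K A P := fun P _ _ _ _ => by
    let := Module.compHom P φ.toRingHom
    refine ⟨fun k a z => ?_⟩
    change φ (k • a) • z = k • φ a • z
    rw [map_smul, smul_assoc]
  have := R.projective 0
  have := R.finite_base 0
  let := Module.compHom X φ.toRingHom
  let := Module.compHom (R.P 0) φ.toRingHom
  have := tower (R.P 0)
  have := Module.Projective.compHom φ hB (R.P 0)
  induction n generalizing X with
  | zero =>
    exact ⟨R.P 0, _, inferInstance, _, ‹_›, R.aug.compHom φ, ‹_›, ‹_›, R.surjective, le_rfl⟩
  | succ n ih =>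
    refine ⟨R.P 0, _, inferInstance, _, ‹_›, R.aug.compHom φ, ‹_›, ‹_›, R.surjective, ?_⟩
    let := Module.compHom (LinearMap.ker R.aug) φ.toRingHom
    have h := ih R.shift (R.projective 1) (R.finite_base 1) (tower (R.P 1))
      (@Module.Projective.compHom K _ A _ _ B _ _ φ hB (R.P 1) _ _ (R.projective 1))
    exact HasSyzygyBound.ker_of_exact (i := (LinearMap.ker R.aug).subtype.compHom φ)
      Subtype.val_injective R.aug.exact_subtype_ker_map h

end RestrictScalars

/-! ### Tensor products of modules and of resolutions -/

section Tensor

variable {K : Type u} [Field K] {Λ : Type v} [Ring Λ] [Algebra K Λ] {Γ : Type w} [Ring Γ]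
  [Algebra K Γ]

attribute [local instance] tensorModule

theorem tensorModule_isScalarTower (M N : Type*)
    [AddCommGroup M] [Module K M] [Module Λ M] [IsScalarTower K Λ M]
    [AddCommGroup N] [Module K N] [Module Γ N] [IsScalarTower K Γ N] :
    IsScalarTower K (Λ ⊗[K] Γ) (M ⊗[K] N) :=
  ⟨fun k a z => by
    induction a with
    | zero => rw [smul_zero, zero_smul, smul_zero]
    | add a b ha hb => rw [smul_add, add_smul, ha, hb, add_smul, smul_add]
    | tmul a b =>
      induction z with
      | zero => rw [smul_zero, smul_zero, smul_zero]
      | add a b ha hb => rw [smul_add, ha, hb, smul_add, smul_add]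
      | tmul m n =>
        rw [TensorProduct.smul_tmul', tensorModule_tmul_smul_tmul, tensorModule_tmul_smul_tmul,
          smul_assoc, TensorProduct.smul_tmul']⟩

attribute [local instance] tensorModule_isScalarTower

/-- A `K`-linear map out of `M ⊗[K] N` is `Λ ⊗[K] Γ`-linear if it is so on pure tensors. -/
def LinearMap.ofTensorModule {M N : Type*}
    [AddCommGroup M] [Module K M] [Module Λ M] [IsScalarTower K Λ M]
    [AddCommGroup N] [Module K N] [Module Γ N] [IsScalarTower K Γ N]
    {Z : Type*} [AddCommGroup Z] [Module K Z] [Module (Λ ⊗[K] Γ) Z]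
    (f : M ⊗[K] N →ₗ[K] Z)
    (hf : ∀ (a : Λ) (b : Γ) m n, f ((a • m) ⊗ₜ (b • n)) = (a ⊗ₜ[K] b) • f (m ⊗ₜ n)) :
    M ⊗[K] N →ₗ[Λ ⊗[K] Γ] Z :=
  { f with
    map_smul' := fun a z => by
      change f (a • z) = a • f z
      induction a with
      | zero => rw [zero_smul, zero_smul, map_zero]
      | add a b ha hb => rw [add_smul, add_smul, map_add, ha, hb]
      | tmul a b =>
        induction z with
        | zero => rw [map_zero, smul_zero, smul_zero, map_zero]
        | add a b ha hb => rw [smul_add, map_add, ha, hb, map_add, smul_add]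
        | tmul m n => exact hf a b m n }

section Map

variable {M M' N N' : Type*}
  [AddCommGroup M] [Module K M] [Module Λ M] [IsScalarTower K Λ M]
  [AddCommGroup M'] [Module K M'] [Module Λ M'] [IsScalarTower K Λ M']
  [AddCommGroup N] [Module K N] [Module Γ N] [IsScalarTower K Γ N]
  [AddCommGroup N'] [Module K N'] [Module Γ N'] [IsScalarTower K Γ N']

variable (K) in
/-- The tensor product of a `Λ`-linear and a `Γ`-linear map. -/
noncomputable def tensorModuleMap (f : M →ₗ[Λ] M') (g : N →ₗ[Γ] N') :
    M ⊗[K] N →ₗ[Λ ⊗[K] Γ] M' ⊗[K] N' :=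
  LinearMap.ofTensorModule (TensorProduct.map (f.restrictScalars K) (g.restrictScalars K))
    fun a b m n => by
      simp only [TensorProduct.map_tmul, LinearMap.restrictScalars_apply, map_smul]
      rfl

variable (K) in
/-- The tensor product of a `Λ`-linear and a `Γ`-linear equivalence. -/
noncomputable def tensorModuleCongr (f : M ≃ₗ[Λ] M') (g : N ≃ₗ[Γ] N') :
    M ⊗[K] N ≃ₗ[Λ ⊗[K] Γ] M' ⊗[K] N' :=
  { tensorModuleMap K f.toLinearMap g.toLinearMap,
    TensorProduct.congr (f.restrictScalars K) (g.restrictScalars K) with }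

end Map

/-- `P` and `Q` are summands of free modules, and the tensor product of free modules is free on the
product of the bases. -/
theorem tensorModule_projective (P Q : Type*)
    [AddCommGroup P] [Module K P] [Module Λ P] [IsScalarTower K Λ P] [hP : Module.Projective Λ P]
    [AddCommGroup Q] [Module K Q] [Module Γ Q] [IsScalarTower K Γ Q]
    [hQ : Module.Projective Γ Q] : Module.Projective (Λ ⊗[K] Γ) (P ⊗[K] Q) := by
  obtain ⟨s, hs⟩ := hP.out
  obtain ⟨t, ht⟩ := hQ.out
  let e := finsuppTensorFinsupp K K Λ Γ P Q
  let f : (P →₀ Λ) ⊗[K] (Q →₀ Γ) →ₗ[Λ ⊗[K] Γ] (P × Q →₀ Λ ⊗[K] Γ) :=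
    LinearMap.ofTensorModule e.toLinearMap fun a b m n => by
      ext ⟨i, j⟩
      simp [e, finsuppTensorFinsupp_apply]
  let e' : (P →₀ Λ) ⊗[K] (Q →₀ Γ) ≃ₗ[Λ ⊗[K] Γ] (P × Q →₀ Λ ⊗[K] Γ) := { f, e with }
  have : Module.Projective (Λ ⊗[K] Γ) ((P →₀ Λ) ⊗[K] (Q →₀ Γ)) :=
    Module.Projective.of_equiv e'.symm
  refine Module.Projective.of_split (tensorModuleMap K s t)
    (tensorModuleMap K (Finsupp.linearCombination Λ id) (Finsupp.linearCombination Γ id)) ?_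
  ext z
  induction z with
  | zero => simp only [map_zero]
  | add a b ha hb => rw [map_add, ha, hb, map_add]
  | tmul p q => exact congrArg₂ (· ⊗ₜ[K] ·) (hs p) (ht q)

section Bounds

variable [FiniteDimensional K Λ]
  {M : Type v} [AddCommGroup M] [Module K M] [Module Λ M] [IsScalarTower K Λ M]
  {N : Type w} [AddCommGroup N] [Module K N] [Module Γ N] [IsScalarTower K Γ N]

/-- Tensoring over a field is exact, so `F ⊗ Q` is a projective resolution of `M ⊗ Q`. -/
theorem MinimalProjectiveResolution.hasSyzygyBound_tensor_projective
    (F : MinimalProjectiveResolution K Λ M)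
    (Q : Type w) [AddCommGroup Q] [Module K Q] [Module Γ Q] [IsScalarTower K Γ Q]
    [Module.Finite K Q] [Module.Projective Γ Q] (n : ℕ) :
    HasSyzygyBound K (Λ ⊗[K] Γ) n (M ⊗[K] Q)
      (Module.finrank K (F.P n) * Module.finrank K Q) := by
  have := F.projective 0
  have := F.finite_base 0
  have := tensorModule_projective (K := K) (Λ := Λ) (Γ := Γ) (F.P 0) Q
  have hs : Function.Surjective (tensorModuleMap K F.aug (LinearMap.id : Q →ₗ[Γ] Q)) :=
    TensorProduct.map_surjective F.surjective Function.surjective_id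
  induction n generalizing M with
  | zero =>
    exact ⟨F.P 0 ⊗[K] Q, _, inferInstance, _, inferInstance,
      tensorModuleMap K F.aug (LinearMap.id : Q →ₗ[Γ] Q), inferInstance, ‹_›, hs,
      (Module.finrank_tensorProduct ..).le⟩
  | succ n ih =>
    refine ⟨F.P 0 ⊗[K] Q, _, inferInstance, _, inferInstance,
      tensorModuleMap K F.aug (LinearMap.id : Q →ₗ[Γ] Q), inferInstance, ‹_›, hs, ?_⟩
    refine HasSyzygyBound.ker_of_exact
      (i := tensorModuleMap K (LinearMap.ker F.aug).subtype (LinearMap.id : Q →ₗ[Γ] Q)) ?_ ?_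
      (ih F.shift (F.shift.projective 0) (F.shift.finite_base 0)
        (@tensorModule_projective _ _ _ _ _ _ _ _ (F.shift.P 0) Q _ _ _ _ (F.shift.projective 0)
          _ _ _ _ _)
        (TensorProduct.map_surjective F.shift.surjective Function.surjective_id))
    · exact Module.Flat.rTensor_preserves_injective_linearMap (M := Q)
        ((LinearMap.ker F.aug).subtype.restrictScalars K) Subtype.val_injective
    · exact rTensor_exact (f := (LinearMap.ker F.aug).subtype.restrictScalars K)
        (g := F.aug.restrictScalars K) Q F.aug.exact_subtype_ker_map F.surjective

theorem MinimalProjectiveResolution.hasSyzygyBound_tensor [FiniteDimensional K Γ]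
    (F : MinimalProjectiveResolution K Λ M) (G : MinimalProjectiveResolution K Γ N) (n : ℕ) :
    HasSyzygyBound K (Λ ⊗[K] Γ) n (M ⊗[K] N)
      (∑ ij ∈ Finset.HasAntidiagonal.antidiagonal n,
        Module.finrank K (F.P ij.1) * Module.finrank K (G.P ij.2)) := by
  induction n generalizing N with
  | zero =>
    have := F.projective 0
    have := F.finite_base 0
    have := G.projective 0
    have := G.finite_base 0
    exact ⟨F.P 0 ⊗[K] G.P 0, _, inferInstance, _, inferInstance, tensorModuleMap K F.aug G.aug,
      inferInstance, tensorModule_projective _ _,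
      TensorProduct.map_surjective F.surjective G.surjective, by simp⟩
  | succ n ih =>
    have := G.projective 0
    have := G.finite_base 0
    -- The summand with `j = 0` comes from resolving `M ⊗ G_0`; those with `j ≥ 1` come from `M ⊗
    -- ΩN`, one degree lower.
    rw [Finset.Nat.sum_antidiagonal_succ']
    refine HasSyzygyBound.cone (p := tensorModuleMap K (LinearMap.id : M →ₗ[Λ] M) G.aug)
      (TensorProduct.map_surjective Function.surjective_id G.surjective)
      (F.hasSyzygyBound_tensor_projective (G.P 0) (n + 1))
      (HasSyzygyBound.ker_of_exact
        (i := tensorModuleMap K (LinearMap.id : M →ₗ[Λ] M) (LinearMap.ker G.aug).subtype) ?_ ?_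
        (ih G.shift))
    · exact Module.Flat.lTensor_preserves_injective_linearMap (M := M)
        ((LinearMap.ker G.aug).subtype.restrictScalars K) Subtype.val_injective
    · exact lTensor_exact (f := (LinearMap.ker G.aug).subtype.restrictScalars K)
        (g := G.aug.restrictScalars K) M G.aug.exact_subtype_ker_map G.surjective

end Bounds

end Tensor

/-! ### Growth rates of convolutions -/

section Growth

/-- The sequence `p` is bounded by a multiple of `n ^ (b - 1)` for `n ≥ 1`. -/
def HasGrowthRate (p : ℕ → ℕ) (b : ℕ) : Prop :=
  ∃ c : ℝ, 0 < c ∧ ∀ n : ℕ, 1 ≤ n → (p n : ℝ) ≤ c * (n : ℝ) ^ ((b : ℤ) - 1)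

namespace HasGrowthRate

theorem mono {p q : ℕ → ℕ} {b : ℕ} (hq : HasGrowthRate q b) (h : ∀ n, p n ≤ q n) :
    HasGrowthRate p b := by
  obtain ⟨c, hc, hb⟩ := hq
  exact ⟨c, hc, fun n hn => (Nat.cast_le.2 (h n)).trans (hb n hn)⟩

/-- A natural number at most `c / n` vanishes once `n > c`; rate `0` thus means finite support. -/
theorem eventually_eq_zero {p : ℕ → ℕ} (h : HasGrowthRate p 0) : ∃ m, ∀ n, m ≤ n → p n = 0 := by
  obtain ⟨c, hc, hb⟩ := h
  obtain ⟨m, hm⟩ := exists_nat_gt c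
  refine ⟨m, fun n hn => ?_⟩
  have hcn : c < n := hm.trans_le (Nat.cast_le.2 hn)
  have hn0 : (0 : ℝ) < n := hc.trans hcn
  have h1 := hb n (Nat.cast_pos.1 hn0)
  have h2 : c * (n : ℝ) ^ (((0 : ℕ) : ℤ) - 1) < 1 := by
    rw [Nat.cast_zero, zero_sub, zpow_neg_one, ← div_eq_mul_inv, div_lt_one hn0]
    exact hcn
  exact Nat.lt_one_iff.1 (by exact_mod_cast h1.trans_lt h2)

theorem of_eventually_eq_zero {p : ℕ → ℕ} {m : ℕ} (h : ∀ n, m ≤ n → p n = 0) :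
    HasGrowthRate p 0 := by
  -- The sum dominates each of the finitely many possibly nonzero `p n * n`; the `1` keeps the
  -- constant positive.
  refine ⟨1 + ∑ n ∈ Finset.range m, (p n : ℝ) * n, by positivity, fun n hn => ?_⟩
  have hn0 : (0 : ℝ) < n := Nat.cast_pos.2 hn
  rw [Nat.cast_zero, zero_sub, zpow_neg_one, ← div_eq_mul_inv, le_div_iff₀ hn0]
  rcases lt_or_ge n m with hnm | hnm
  · have := Finset.single_le_sum (f := fun n : ℕ => (p n : ℝ) * n) (fun i _ => by positivity)
      (Finset.mem_range.2 hnm)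
    linarith
  · rw [h n hnm, Nat.cast_zero, zero_mul]
    positivity

/-- For positive rate the bounding power is monotone, so one bound serves all `i ≤ n`. The value `p
0`, not controlled by the rate, is absorbed into the constant. -/
theorem exists_le_pow {p : ℕ → ℕ} {b : ℕ} (h : HasGrowthRate p (b + 1)) :
    ∃ c : ℝ, 0 < c ∧ ∀ n : ℕ, 1 ≤ n → ∀ i ≤ n, (p i : ℝ) ≤ c * (n : ℝ) ^ b := by
  obtain ⟨c, hc, hb⟩ := h
  refine ⟨c + p 0, by positivity, fun n hn i hi => ?_⟩
  have hn1 : (1 : ℝ) ≤ n := Nat.one_le_cast.2 hn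
  rw [add_mul]
  rcases Nat.eq_zero_or_pos i with rfl | hi0
  · have : (p 0 : ℝ) * 1 ≤ p 0 * (n : ℝ) ^ b := by
      gcongr
      exact one_le_pow₀ hn1
    have : 0 ≤ c * (n : ℝ) ^ b := by positivity
    linarith
  · have h1 := hb i hi0
    rw [Nat.cast_add, Nat.cast_one, add_sub_cancel_right, zpow_natCast] at h1
    have : c * (i : ℝ) ^ b ≤ c * (n : ℝ) ^ b := by gcongr
    have : 0 ≤ (p 0 : ℝ) * (n : ℝ) ^ b := by positivity
    linarith

theorem of_le_pow {p : ℕ → ℕ} {b : ℕ} {c : ℝ} (hc : 0 < c)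
    (h : ∀ n : ℕ, 1 ≤ n → (p n : ℝ) ≤ c * (n : ℝ) ^ b) : HasGrowthRate p (b + 1) :=
  ⟨c, hc, fun n hn => by
    rw [Nat.cast_add, Nat.cast_one, add_sub_cancel_right, zpow_natCast]
    exact h n hn⟩

/-- Rate `0` is treated separately because `n⁻¹` is not monotone. Since `p` has finite support, the
convolution is at most `∑ p i` times the bound on `q`, or has finite support if `q` does. -/
theorem convolution_of_zero {p q : ℕ → ℕ} {b : ℕ} (hp : HasGrowthRate p 0)
    (hq : HasGrowthRate q b) :
    HasGrowthRate (fun n => ∑ ij ∈ Finset.HasAntidiagonal.antidiagonal n, p ij.1 * q ij.2) b := by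
  obtain ⟨k, hk⟩ := hp.eventually_eq_zero
  cases b with
  | zero =>
    obtain ⟨l, hl⟩ := hq.eventually_eq_zero
    refine of_eventually_eq_zero (m := k + l) fun n hn => Finset.sum_eq_zero ?_
    rintro ⟨i, j⟩ hij
    rw [Finset.HasAntidiagonal.mem_antidiagonal] at hij
    rcases le_or_gt k i with h | h
    · simp [hk i h]
    · simp [hl j (by omega)]
  | succ b =>
    obtain ⟨c, hc, hb⟩ := hq.exists_le_pow
    refine of_le_pow (c := c * (1 + ∑ i ∈ Finset.range k, (p i : ℝ))) (by positivity)
      fun n hn => ?_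
    have h0 : ∑ i ∈ Finset.range n.succ, p i ≤ ∑ i ∈ Finset.range k, p i := by
      refine Finset.sum_le_sum_of_ne_zero fun i _ hi => ?_
      by_contra hik
      exact hi (hk i (by simpa using hik))
    have h1 : ∑ i ∈ Finset.range n.succ, (p i : ℝ) ≤ ∑ i ∈ Finset.range k, (p i : ℝ) := by
      exact_mod_cast h0
    push_cast
    calc _ ≤ ∑ ij ∈ Finset.HasAntidiagonal.antidiagonal n, (p ij.1 : ℝ) * (c * (n : ℝ) ^ b) := by
          refine Finset.sum_le_sum fun ij hij => ?_
          rw [Finset.HasAntidiagonal.mem_antidiagonal] at hij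
          gcongr
          exact hb n hn _ (by omega)
      _ = (∑ i ∈ Finset.range n.succ, (p i : ℝ)) * (c * (n : ℝ) ^ b) := by
          rw [Finset.Nat.sum_antidiagonal_eq_sum_range_succ_mk, Finset.sum_mul]
      _ ≤ (1 + ∑ i ∈ Finset.range k, (p i : ℝ)) * (c * (n : ℝ) ^ b) := by
          gcongr
          linarith
      _ = _ := by ring

theorem convolution {p q : ℕ → ℕ} {a b : ℕ} (hp : HasGrowthRate p a) (hq : HasGrowthRate q b) :
    HasGrowthRate (fun n => ∑ ij ∈ Finset.HasAntidiagonal.antidiagonal n, p ij.1 * q ij.2)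
      (a + b) := by
  cases a with
  | zero => rw [zero_add]; exact hp.convolution_of_zero hq
  | succ a =>
    cases b with
    | zero =>
      refine (hq.convolution_of_zero hp).mono fun n => ?_
      rw [← Finset.Nat.sum_antidiagonal_swap]
      simp [mul_comm]
    | succ b =>
      obtain ⟨c, hc, hp⟩ := hp.exists_le_pow
      obtain ⟨d, hd, hq⟩ := hq.exists_le_pow
      rw [← add_assoc]
      -- There are `n + 1 ≤ 2 * n` summands, each at most `c * d * n ^ (a + b)`.
      refine of_le_pow (c := 2 * (c * d)) (by positivity) fun n hn => ?_
      have hn1 : (1 : ℝ) ≤ n := Nat.one_le_cast.2 hn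
      push_cast
      calc _ ≤ ∑ ij ∈ Finset.HasAntidiagonal.antidiagonal n,
              (c * (n : ℝ) ^ a) * (d * (n : ℝ) ^ b) := by
            refine Finset.sum_le_sum fun ij hij => ?_
            rw [Finset.HasAntidiagonal.mem_antidiagonal] at hij
            gcongr
            · exact hp n hn _ (by omega)
            · exact hq n hn _ (by omega)
        _ = (n + 1) * ((c * (n : ℝ) ^ a) * (d * (n : ℝ) ^ b)) := by
            rw [Finset.sum_const, Finset.Nat.card_antidiagonal, nsmul_eq_mul]
            push_cast
            rfl
        _ ≤ (2 * n) * ((c * (n : ℝ) ^ a) * (d * (n : ℝ) ^ b)) := by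
            gcongr
            linarith
        _ = _ := by ring

end HasGrowthRate

end Growth

/-! ### The two inequalities for complexity -/

section Complexity

theorem complexity_eq {K : Type u} [Field K] {A : Type v} [Ring A] [Algebra K A]
    {M : Type w} [AddCommGroup M] [Module A M] :
    complexity K A M = sInf ((fun b : ℕ => (b : ℕ∞)) '' {b : ℕ |
      ∃ F : MinimalProjectiveResolution K A M,
        HasGrowthRate (fun n => Module.finrank K (F.P n)) b}) := rfl

/-- A finite infimum in `ℕ∞` is over a nonempty set and is attained by well-ordering. -/
theorem exists_complexity_eq {K : Type u} [Field K] {A : Type v} [Ring A] [Algebra K A]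
    {M : Type w} [AddCommGroup M] [Module A M] (h : complexity K A M ≠ ⊤) :
    ∃ (b : ℕ) (F : MinimalProjectiveResolution K A M),
      HasGrowthRate (fun n => Module.finrank K (F.P n)) b ∧ complexity K A M = b := by
  rw [complexity_eq] at h ⊢
  obtain ⟨b, ⟨F, hF⟩, hb⟩ := csInf_mem (Set.nonempty_iff_ne_empty.2 fun h0 =>
    h ((congrArg sInf h0).trans sInf_empty))
  exact ⟨b, F, hF, hb.symm⟩

/-- If `B` is projective over `A` and `M` is an `A`-retract of the `B`-module `X`, then the
complexity of `M` is at most that of `X`. -/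
theorem complexity_le_of_retract {K : Type u} [Field K] {A : Type v} [Ring A] [Algebra K A]
    [FiniteDimensional K A] {B : Type w} [Ring B] [Algebra K B] [FiniteDimensional K B]
    (φ : A →ₐ[K] B)
    (hB : letI := Module.compHom B φ.toRingHom; Module.Projective A B)
    {M : Type v} [AddCommGroup M] [Module A M] [Module.Finite A M]
    {X : Type w} [AddCommGroup X] [Module B X] (ι : M →+ X) (π : X →+ M)
    (hι : ∀ a m, ι (a • m) = φ a • ι m) (hπ : ∀ a z, π (φ a • z) = a • π z)
    (h : ∀ m, π (ι m) = m) : complexity K A M ≤ complexity K B X := by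
  by_cases htop : complexity K B X = ⊤
  · rw [htop]; exact le_top
  obtain ⟨b, R, hR, hb⟩ := exists_complexity_eq htop
  obtain ⟨F⟩ := MinimalProjectiveResolution.nonempty K (A := A) M
  rw [hb, complexity_eq]
  refine sInf_le ⟨b, ⟨F, hR.mono fun n => ?_⟩, rfl⟩
  let := Module.compHom X φ.toRingHom
  let ι' : M →ₗ[A] X := { ι with map_smul' := hι }
  let π' : X →ₗ[A] M := { π with map_smul' := hπ }
  have hid : π' ∘ₗ ι' = LinearMap.id := LinearMap.ext h
  exact F.finrank_le ι' π' (by rw [hid]; exact Function.bijective_id)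
    (R.hasSyzygyBound_compHom φ hB n)

variable (K : Type u) [Field K] (Λ : Type v) [Ring Λ] [Algebra K Λ] (Γ : Type w) [Ring Γ]
  [Algebra K Γ]

theorem tensorProduct_projective_left :
    letI := Module.compHom (Λ ⊗[K] Γ)
      (Algebra.TensorProduct.includeLeft : Λ →ₐ[K] Λ ⊗[K] Γ).toRingHom
    Module.Projective Λ (Λ ⊗[K] Γ) := by
  have h : Module.Projective Λ (Λ ⊗[K] Γ) := inferInstance
  -- Projectivity is known for the standard left action on the tensor product; it remains to
  -- identify that action with the restricted one.
  convert h
  refine Module.ext' _ _ fun a z => ?_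
  change (a ⊗ₜ[K] (1 : Γ)) * z = a • z
  induction z with
  | zero => rw [mul_zero, smul_zero]
  | add y z hy hz => rw [mul_add, hy, hz, smul_add]
  | tmul y z => rw [Algebra.TensorProduct.tmul_mul_tmul, one_mul]; rfl

theorem tensorProduct_projective_right :
    letI := Module.compHom (Λ ⊗[K] Γ)
      (Algebra.TensorProduct.includeRight : Γ →ₐ[K] Λ ⊗[K] Γ).toRingHom
    Module.Projective Γ (Λ ⊗[K] Γ) := by
  let := Module.compHom (Λ ⊗[K] Γ)
      (Algebra.TensorProduct.includeRight : Γ →ₐ[K] Λ ⊗[K] Γ).toRingHom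
  let e : Γ ⊗[K] Λ ≃ₗ[Γ] Λ ⊗[K] Γ :=
    { Algebra.TensorProduct.comm K Γ Λ with
      map_smul' := fun a z => by
        change Algebra.TensorProduct.comm K Γ Λ (a • z) =
          ((1 : Λ) ⊗ₜ[K] a) * Algebra.TensorProduct.comm K Γ Λ z
        induction z with
        | zero => rw [smul_zero, map_zero, mul_zero]
        | add y z hy hz => rw [smul_add, map_add, hy, hz, map_add, mul_add]
        | tmul y z =>
          rw [TensorProduct.smul_tmul', Algebra.TensorProduct.comm_tmul,
            Algebra.TensorProduct.comm_tmul, Algebra.TensorProduct.tmul_mul_tmul, one_mul,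
            smul_eq_mul] }
  exact Module.Projective.of_equiv e

theorem exists_dual_apply_eq_one {V : Type*} [AddCommGroup V] [Module K V] [Nontrivial V] :
    ∃ (v : V) (f : V →ₗ[K] K), f v = 1 := by
  obtain ⟨v, hv⟩ := exists_ne (0 : V)
  obtain ⟨f, hf⟩ := not_forall.1 (mt (Module.forall_dual_apply_eq_zero_iff K v).1 hv)
  exact ⟨v, (f v)⁻¹ • f, by simp [hf]⟩

attribute [local instance] tensorModule

variable [FiniteDimensional K Λ] [FiniteDimensional K Γ]
  (M : Type v) [AddCommGroup M] [Module K M] [Module Λ M] [IsScalarTower K Λ M]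
  (N : Type w) [AddCommGroup N] [Module K N] [Module Γ N] [IsScalarTower K Γ N]

/-- With `f n = 1`, the map `m ↦ m ⊗ n` is split over `Λ` by `id ⊗ f`. -/
theorem complexity_left_le [Module.Finite Λ M] [Nontrivial N] :
    complexity K Λ M ≤ complexity K (Λ ⊗[K] Γ) (M ⊗[K] N) := by
  obtain ⟨n, f, hf⟩ := exists_dual_apply_eq_one K (V := N)
  refine complexity_le_of_retract Algebra.TensorProduct.includeLeft
    (tensorProduct_projective_left K Λ Γ)
    (((TensorProduct.mk K M N).flip n).toAddMonoidHom)
    ((TensorProduct.rid K M).toLinearMap ∘ₗ f.lTensor M).toAddMonoidHom ?_ ?_ ?_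
  · intro a m
    change (a • m) ⊗ₜ[K] n = (a ⊗ₜ[K] (1 : Γ)) • (m ⊗ₜ[K] n)
    rw [tensorModule_tmul_smul_tmul, one_smul]
  · intro a z
    change TensorProduct.rid K M (f.lTensor M ((a ⊗ₜ[K] (1 : Γ)) • z)) =
      a • TensorProduct.rid K M (f.lTensor M z)
    induction z with
    | zero => simp only [smul_zero, map_zero]
    | add y z hy hz => simp only [smul_add, map_add, hy, hz]
    | tmul y z =>
      rw [tensorModule_tmul_smul_tmul, one_smul, LinearMap.lTensor_tmul, LinearMap.lTensor_tmul,
        TensorProduct.rid_tmul, TensorProduct.rid_tmul, smul_comm]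
  · intro m
    change TensorProduct.rid K M (f.lTensor M (m ⊗ₜ n)) = m
    rw [LinearMap.lTensor_tmul, hf, TensorProduct.rid_tmul, one_smul]

theorem complexity_right_le [Module.Finite Γ N] [Nontrivial M] :
    complexity K Γ N ≤ complexity K (Λ ⊗[K] Γ) (M ⊗[K] N) := by
  obtain ⟨m, f, hf⟩ := exists_dual_apply_eq_one K (V := M)
  refine complexity_le_of_retract Algebra.TensorProduct.includeRight
    (tensorProduct_projective_right K Λ Γ)
    ((TensorProduct.mk K M N m).toAddMonoidHom)
    ((TensorProduct.lid K N).toLinearMap ∘ₗ f.rTensor N).toAddMonoidHom ?_ ?_ ?_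
  · intro a n
    change m ⊗ₜ[K] (a • n) = ((1 : Λ) ⊗ₜ[K] a) • (m ⊗ₜ[K] n)
    rw [tensorModule_tmul_smul_tmul, one_smul]
  · intro a z
    change TensorProduct.lid K N (f.rTensor N (((1 : Λ) ⊗ₜ[K] a) • z)) =
      a • TensorProduct.lid K N (f.rTensor N z)
    induction z with
    | zero => simp only [smul_zero, map_zero]
    | add y z hy hz => simp only [smul_add, map_add, hy, hz]
    | tmul y z =>
      rw [tensorModule_tmul_smul_tmul, one_smul, LinearMap.rTensor_tmul, LinearMap.rTensor_tmul,
        TensorProduct.lid_tmul, TensorProduct.lid_tmul, smul_comm]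
  · intro n
    change TensorProduct.lid K N (f.rTensor N (m ⊗ₜ n)) = n
    rw [LinearMap.rTensor_tmul, hf, TensorProduct.lid_tmul, one_smul]

theorem complexity_tensor_le [Module.Finite Λ M] [Module.Finite Γ N] :
    complexity K (Λ ⊗[K] Γ) (M ⊗[K] N) ≤ complexity K Λ M + complexity K Γ N := by
  by_cases hM : complexity K Λ M = ⊤
  · rw [hM, top_add]; exact le_top
  by_cases hN : complexity K Γ N = ⊤
  · rw [hN, add_top]; exact le_top
  obtain ⟨a, F, hF, ha⟩ := exists_complexity_eq hM
  obtain ⟨b, G, hG, hb⟩ := exists_complexity_eq hN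
  have : Module.Finite K M := Module.Finite.trans Λ M
  have : Module.Finite K N := Module.Finite.trans Γ N
  have := tensorModule_isScalarTower (K := K) (Λ := Λ) (Γ := Γ) M N
  have : Module.Finite (Λ ⊗[K] Γ) (M ⊗[K] N) := Module.Finite.of_restrictScalars_finite K _ _
  obtain ⟨R⟩ := MinimalProjectiveResolution.nonempty K (A := Λ ⊗[K] Γ) (M ⊗[K] N)
  rw [ha, hb, complexity_eq]
  refine sInf_le ⟨a + b, ⟨R, (hF.convolution hG).mono fun n => ?_⟩, by push_cast; rfl⟩
  -- `M ⊗ N` is compared with itself as a trivial retract.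
  exact R.finrank_le LinearMap.id LinearMap.id Function.bijective_id (F.hasSyzygyBound_tensor G n)

end Complexity

theorem proposition5p4 (K : Type*) [Field K]
    (Λ : Type*) [Ring Λ] [Algebra K Λ] [FiniteDimensional K Λ]
    (Γ : Type*) [Ring Γ] [Algebra K Γ] [FiniteDimensional K Γ]
    (M : Type*) [AddCommGroup M] [Module K M] [Module Λ M] [IsScalarTower K Λ M]
    [Module.Finite Λ M]
    (N : Type*) [AddCommGroup N] [Module K N] [Module Γ N] [IsScalarTower K Γ N]
    [Module.Finite Γ N] :
    letI : Module (Λ ⊗[K] Γ) (M ⊗[K] N) := tensorModule K Λ Γ M N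
    (Nontrivial M → Nontrivial N →
      max (complexity K Λ M) (complexity K Γ N) ≤ complexity K (Λ ⊗[K] Γ) (M ⊗[K] N)) ∧
    complexity K (Λ ⊗[K] Γ) (M ⊗[K] N) ≤ complexity K Λ M + complexity K Γ N := by
  -- Isomorphic quotients of `Λ^m` and `Γ^n` replace `M` and `N`, since the inequalities above are
  -- for modules in the universes of their algebras.
  obtain ⟨m, f, hf⟩ := Module.Finite.exists_fin' Λ M
  obtain ⟨n, g, hg⟩ := Module.Finite.exists_fin' Γ N
  let e := f.quotKerEquivOfSurjective hf
  let e' := g.quotKerEquivOfSurjective hg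
  let := tensorModule K Λ Γ M N
  let := tensorModule K Λ Γ ((Fin m → Λ) ⧸ LinearMap.ker f) ((Fin n → Γ) ⧸ LinearMap.ker g)
  rw [← complexity_congr e, ← complexity_congr e', ← complexity_congr (tensorModuleCongr K e e')]
  refine ⟨fun hM hN => ?_, complexity_tensor_le ..⟩
  have := e.toEquiv.nontrivial
  have := e'.toEquiv.nontrivial
  exact max_le (complexity_left_le ..) (complexity_right_le ..)
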